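/- Let $m,n\ge 1$ be integers, let $V_1,\dots,V_m$ be pairwise disjoint finite sets of vertices, put $V:=V_1\cup\cdots\cup V_m$, and let $v_1,\dots,v_n$ be $n$ additional single vertices, distinct from each other and not in $V$. Put $V_{m+j}:=\{v_j\}$ for $j=1,\dots,n$. A (rooted) forest on the collection $(V_k)_{k=1}^{m+n}$ is a graph on the vertex set $V\cup\{v_1,\dots,v_n\}$ such that (i) its connected components are trees; (ii) there is no edge between two vertices of the same set $V_k$; (iii) the reduced graph, obtained by contracting each set $V_k$ to a single point and replacing all edges between two different sets by a single edge, is a (connected) tree; (iv) whenever $k\ge 2$ and $V_i$ is the neighbour of $V_k$ on the path from $V_k$ to $V_1$ in the reduced tree, all edges between $V_i$ and $V_k$ emanate from one single vertex of $V_i$. Let $a>0$ and $\lambda>0$ be real numbers. Give each forest the weight $a^{e_1}\lambda^{e_2}$, where $e_1$ is the number of its edges between two additional vertices $v_k$ and $v_l$ and $e_2$ is the number of all its other edges, and let $Q_n(m)$ be the sum of the weights of all forests on $(V_k)_{k=1}^{m+n}$. Then $$Q_n(m)=|V_1|\,\lambda\left(\prod_{i=2}^m\left((1+\lambda)^{|V_i|}-1\right)\right)(|V|+n)^{m-1}(\lambda|V|+na)^{n-1}.$$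 -/

import Mathlib

/-- The reduced graph of a graph `G` on a disjoint union of sets of vertices. The sets are indexed
by `ι`, and `c x` is the index of the set that contains the vertex `x`. Every set is contracted to
the single point `i : ι`, and all the lines between two different sets become a single line. -/
def reducedGraph {X ι : Type*} (c : X → ι) (G : SimpleGraph X) : SimpleGraph ι where
  Adj i j := i ≠ j ∧ ∃ x y, c x = i ∧ c y = j ∧ G.Adj x y
  symm := ⟨fun _ _ ⟨hne, x, y, hx, hy, h⟩ => ⟨hne.symm, y, x, hy, hx, h.symm⟩⟩
  loopless := ⟨fun _ h => h.1 rfl⟩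

/-- `G` is a rooted forest on the collection of the sets of vertices `c ⁻¹' {i}`, `i : ι`, in which
the set with index `r` plays the part of the first set of the collection. -/
structure IsRootedForest {X ι : Type*} (c : X → ι) (r : ι) (G : SimpleGraph X) : Prop where
  /-- The connected components of `G` are trees. -/
  acyclic : G.IsAcyclic
  /-- There are no lines between vertices of the same set. -/
  no_inner_line : ∀ x y, G.Adj x y → c x ≠ c y
  /-- The graph reduces to a single (connected) tree. -/
  reduced_isTree : (reducedGraph c G).IsTree
  /-- If, in the reduced tree, the set `j ≠ r` is connected to the set `i` in the path from
  `j` to `r`, then all lines between the sets `i` and `j` emanate from a single vertex of `i`. -/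
  single_root : ∀ i j : ι, j ≠ r → (reducedGraph c G).Adj j i →
    (∃ p : (reducedGraph c G).Walk j r, p.IsPath ∧ i ∈ p.support) →
    ∃ x, c x = i ∧ ∀ u v, c u = i → c v = j → G.Adj u v → u = x

/-- The collection consisting of the sets `V i`, `i : Fin m`, and of `n` additional single
vertices, each of which is a set of the collection by itself: the map that sends a vertex to the
index of its set. -/
def setIndex {m : ℕ} (V : Fin m → Type*) (n : ℕ) : (Σ i, V i) ⊕ Fin n → Fin m ⊕ Fin n :=
  Sum.map Sigma.fst id

open Classical in
/-- The factor contributed by a line: `a` if both its endpoints are additional vertices,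
and `l` otherwise. -/
noncomputable def lineFactor {A B : Type*} (a l : ℝ) (e : Sym2 (A ⊕ B)) : ℝ :=
  if ∀ x ∈ e, x.isRight = true then a else l

open Classical in
/-- The quantity `Q_n(m)`: the sum over all the rooted forests on the sets `V i`, `i : Fin m`,
together with `n` additional single vertices, of the product of the factors of their lines. The
set `V r` is the first set of the collection. -/
noncomputable def forestWeight {m : ℕ} (V : Fin m → Type*) [∀ i, Fintype (V i)] (r : Fin m)
    (n : ℕ) (a l : ℝ) : ℝ :=
  ∑ G : SimpleGraph ((Σ i, V i) ⊕ Fin n) with IsRootedForest (setIndex V n) (Sum.inl r) G,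
    ∏ e ∈ G.edgeFinset, lineFactor a l e

/-!
The idea: a rooted forest is the same as a choice, for every set `j` of the collection other than
the first set `r`, of a vertex `x` of another set and of a nonempty set `S` of vertices of `j`, the
star with centre `x` and leaves `S` being the set of lines from `j` towards the root. The only
condition is that the resulting parent map on the indices has no cycle, so that every index leads
to `r`. Nothing has to be required for the forest to be acyclic, since every vertex has at most one
neighbour that is closer to the root. This bijection is `IsStarSystem.isRootedForest`,
`IsStarSystem.starGraph_injective` and `IsRootedForest.exists_isStarSystem`.

The weight is a product over `j` of the weights of the choices, so a directed matrix-tree theorem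
(`sum_isGrounded_eq_det`) turns the sum into a determinant. It is proved by multilinearity: row `j`
is the weighted sum over the choices of the differences `e_j - e_(parent of j)`, and the determinant
of a matrix with rows `e_j - e_(f j)` is `1` if `f` leads every index to `r`, and `0` otherwise.

In the case at hand the weights of the choices depend on `j` only up to a factor and the type of `j`
(one of the sets `V i`, or an additional vertex). Hence the matrix is diagonal up to a matrix of
rank two, and `det_two_row_types` evaluates its determinant.
-/

/-! ### Grounded maps and a directed matrix-tree theorem -/

universe u

/-- A map `f` that assigns a parent to every point other than `r` is *grounded* if there is no
infinite chain of iterated parents, that is (on a finite type), if every point leads to `r`. -/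
def IsGrounded {ι : Type*} (r : ι) (f : {j // j ≠ r} → ι) : Prop :=
  WellFounded fun i j : ι => ∃ h : j ≠ r, f ⟨j, h⟩ = i

theorem IsGrounded.exists_rank {ι : Type u} {r : ι} {f : {j // j ≠ r} → ι} (hf : IsGrounded r f) :
    ∃ d : ι → Ordinal.{u}, ∀ j, d (f j) < d j := by
  have : IsWellFounded ι (fun i j : ι => ∃ h : j ≠ r, f ⟨j, h⟩ = i) := ⟨hf⟩
  exact ⟨IsWellFounded.rank (fun i j : ι => ∃ h : j ≠ r, f ⟨j, h⟩ = i),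
    fun j => IsWellFounded.rank_lt_of_rel ⟨j.2, rfl⟩⟩

theorem isGrounded_of_rank {ι α : Type*} [Preorder α] [WellFoundedLT α] {r : ι}
    {f : {j // j ≠ r} → ι} (d : ι → α) (hd : ∀ j, d (f j) < d j) : IsGrounded r f := by
  refine Subrelation.wf ?_ (InvImage.wf d (wellFounded_lt (α := α)))
  rintro i j ⟨h, rfl⟩
  exact hd ⟨j, h⟩

section MatrixTree

variable {ι R Y : Type*} [Fintype ι] [DecidableEq ι] [CommRing R]

/-- For a grounded map the matrix is triangular, with unit diagonal, with respect to the rank. -/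
theorem det_one_sub_parent_of_isGrounded {r : ι} {f : {j // j ≠ r} → ι}
    (hf : IsGrounded r f) :
    (Matrix.of fun j k : {j // j ≠ r} =>
      (if j = k then (1 : R) else 0) - if f j = k then 1 else 0).det = 1 := by
  obtain ⟨d, hd⟩ := hf.exists_rank
  set M := Matrix.of fun j k : {j // j ≠ r} =>
      (if j = k then (1 : R) else 0) - if f j = k then 1 else 0 with hM
  have htri : M.BlockTriangular (fun j => OrderDual.toDual (d j.1)) := by
    intro j k hjk
    replace hjk : d j < d k := hjk
    have h1 : j ≠ k := by rintro rfl; exact hjk.false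
    have h2 : f j ≠ k := fun h => (hjk.trans (h ▸ hd j)).false
    simp [hM, h1, h2]
  rw [htri.det]
  refine Finset.prod_eq_one fun a _ => ?_
  suffices h : M.toSquareBlock (fun j => OrderDual.toDual (d j.1)) a = 1 by rw [h, Matrix.det_one]
  ext j k
  have h2 : f j.1 ≠ k.1 := by
    intro h
    have hj := j.2
    have hk := k.2
    have := hd j.1
    rw [h] at this
    exact this.ne (OrderDual.toDual.injective (hk.trans hj.symm))
  simp [Matrix.toSquareBlock_def, hM, h2, Matrix.one_apply, Subtype.ext_iff]

/-- If the map is not grounded, the indicator of the points that do not lead to `r` lies in the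
kernel of the matrix. -/
theorem det_one_sub_parent_of_not_isGrounded [IsDomain R] {r : ι}
    {f : {j // j ≠ r} → ι} (hf : ¬ IsGrounded r f) :
    (Matrix.of fun j k : {j // j ≠ r} =>
      (if j = k then (1 : R) else 0) - if f j = k then 1 else 0).det = 0 := by
  classical
  set rel : ι → ι → Prop := fun i j => ∃ h : j ≠ r, f ⟨j, h⟩ = i with hrel
  have hr : Acc rel r := Acc.intro _ fun y ⟨h, _⟩ => (h rfl).elim
  have hiff : ∀ j : {j // j ≠ r}, Acc rel j ↔ Acc rel (f j) := fun j =>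
    ⟨fun h => h.inv ⟨j.2, rfl⟩, fun h => Acc.intro _ fun y ⟨_, hy⟩ => hy ▸ h⟩
  obtain ⟨x, hx⟩ : ∃ x, ¬ Acc rel x := by
    by_contra! h
    exact hf ⟨h⟩
  have hxr : x ≠ r := by rintro rfl; exact hx hr
  rw [← Matrix.exists_mulVec_eq_zero_iff]
  refine ⟨fun j => if Acc rel j.1 then 0 else 1, fun h => ?_, ?_⟩
  · have := congrFun h ⟨x, hxr⟩
    simp [hx] at this
  · ext j
    have key : ∑ k : {j // j ≠ r}, (if f j = k then (1 : R) else 0) *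
        (if Acc rel k.1 then 0 else 1) = if Acc rel (f j) then 0 else 1 := by
      by_cases hj : f j = r
      · rw [Finset.sum_eq_zero, if_pos (hj ▸ hr)]
        intro k _
        rw [if_neg fun h => k.2 (h.symm.trans hj), zero_mul]
      · rw [Finset.sum_eq_single ⟨f j, hj⟩]
        · simp
        · intro k _ hk
          rw [if_neg fun h => hk (Subtype.ext h.symm), zero_mul]
        · simp
    simp only [Matrix.mulVec, dotProduct, Matrix.of_apply, sub_mul, Finset.sum_sub_distrib, key]
    by_cases h : Acc rel (f j) <;> simp [h, hiff j, ite_mul, -mul_ite]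

open Classical in
/-- A directed matrix-tree theorem. Every point `j ≠ r` chooses an element `y` of `A j`, with
weight `w j y`, and thereby the parent `g y`; the sum of the weights of the choices for which the
parent map is grounded is a determinant. It follows by expanding the determinant along its rows. -/
theorem sum_isGrounded_eq_det [IsDomain R] (r : ι) (A : {j // j ≠ r} → Finset Y)
    (w : {j // j ≠ r} → Y → R) (g : Y → ι) :
    ∑ p ∈ Fintype.piFinset A with IsGrounded r fun j => g (p j), ∏ j, w j (p j) =
      (Matrix.of fun j k : {j // j ≠ r} =>
        ∑ y ∈ A j, w j y * ((if j = k then 1 else 0) - if g y = k then 1 else 0)).det := by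
  have hM : (Matrix.of fun j k : {j // j ≠ r} =>
        ∑ y ∈ A j, w j y * ((if j = k then 1 else 0) - if g y = k then 1 else 0)) =
      fun j => ∑ y ∈ A j, w j y •
        fun k : {j // j ≠ r} => ((if j = k then (1 : R) else 0) - if g y = k then 1 else 0) := by
    ext j k
    simp [Finset.sum_apply]
  rw [hM]
  change _ = (Matrix.detRowAlternating (R := R)).toMultilinearMap _
  rw [MultilinearMap.map_sum_finset, Finset.sum_filter]
  refine Finset.sum_congr rfl fun p _ => ?_
  rw [MultilinearMap.map_smul_univ, smul_eq_mul]
  by_cases h : IsGrounded r fun j => g (p j)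
  · rw [if_pos h]
    exact (mul_one _).symm.trans (congrArg _ (det_one_sub_parent_of_isGrounded h).symm)
  · rw [if_neg h]
    exact (mul_zero _).symm.trans (congrArg _ (det_one_sub_parent_of_not_isGrounded h).symm)

end MatrixTree

/-! ### Rooted forests as star systems -/

/-- A graph is acyclic if its vertices can be ranked so that every vertex has at most one
neighbour that is not of higher rank. -/
theorem isAcyclic_of_rank {V α : Type*} [LinearOrder α] {G : SimpleGraph V} (d : V → α)
    (h : ∀ u v w, G.Adj u v → G.Adj u w → d v ≤ d u → d w ≤ d u → v = w) : G.IsAcyclic := by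
  classical
  intro x p hp
  -- A vertex of maximal rank on a cycle would have two such neighbours.
  obtain ⟨u, hu, hmax⟩ := p.support.toFinset.exists_max_image d ⟨x, by simp⟩
  rw [List.mem_toFinset] at hu
  have hq := hp.rotate hu
  set q := p.rotate u hu
  have hmem : ∀ v ∈ q.support, d v ≤ d u := fun v hv => by
    refine hmax v ?_
    rw [List.mem_toFinset]
    exact (p.mem_support_rotate_iff u hu).1 hv
  exact hq.snd_ne_penultimate (h u _ _ (q.adj_snd hq.not_nil) (q.adj_penultimate hq.not_nil).symm
    (hmem _ (q.getVert_mem_support _)) (hmem _ (q.getVert_mem_support _)))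

section Stars

variable {X ι : Type*} {c : X → ι} {r : ι}

/-- The union, over all `j ≠ r`, of the stars with centre `(p j).1` and set of leaves `(p j).2`. -/
def starGraph (p : {j // j ≠ r} → X × Finset X) : SimpleGraph X :=
  SimpleGraph.fromRel fun u v => ∃ j, (p j).1 = u ∧ v ∈ (p j).2

/-- The data that encode a rooted forest: for each `j ≠ r`, the vertex `(p j).1` of the parent set
from which the lines to the set `j` emanate, and the nonempty set `(p j).2` of their endpoints in
the set `j`. The index `c (p j).1` is that of the parent of `j`. -/
structure IsStarSystem (c : X → ι) (r : ι) (p : {j // j ≠ r} → X × Finset X) : Prop where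
  nonempty : ∀ j, (p j).2.Nonempty
  index : ∀ j, ∀ y ∈ (p j).2, c y = j
  grounded : IsGrounded r fun j => c (p j).1

namespace IsStarSystem

variable {p q : {j // j ≠ r} → X × Finset X}

theorem parent_ne (hp : IsStarSystem c r p) (j : {j // j ≠ r}) : c (p j).1 ≠ j := by
  obtain ⟨d, hd⟩ := hp.grounded.exists_rank
  intro h
  exact (hd j).ne (congrArg d h)

theorem parent_asymm (hp : IsStarSystem c r p) {j k : {j // j ≠ r}} (h : c (p j).1 = k) :
    c (p k).1 ≠ j := by
  obtain ⟨d, hd⟩ := hp.grounded.exists_rank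
  intro h'
  have h1 := hd j
  have h2 := hd k
  simp only [h, h'] at h1 h2
  exact (h1.trans h2).false

theorem adj_center (hp : IsStarSystem c r p) {j : {j // j ≠ r}} {y : X} (hy : y ∈ (p j).2) :
    (starGraph p).Adj (p j).1 y := by
  refine (SimpleGraph.fromRel_adj _ _ _).2 ⟨?_, Or.inl ⟨j, rfl, hy⟩⟩
  intro h
  exact hp.parent_ne j (by rw [h, hp.index j y hy])

theorem adj_cases {u v : X} (h : (starGraph p).Adj u v) :
    (∃ j, (p j).1 = u ∧ v ∈ (p j).2) ∨ ∃ j, (p j).1 = v ∧ u ∈ (p j).2 :=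
  ((SimpleGraph.fromRel_adj _ _ _).1 h).2

/-- The lines between a set and its parent are those of the star of that set. -/
theorem eq_center_of_adj (hp : IsStarSystem c r p) {u v : X} (h : (starGraph p).Adj u v)
    {j : {j // j ≠ r}} (hv : c v = j) (hu : c u = c (p j).1) : u = (p j).1 ∧ v ∈ (p j).2 := by
  rcases adj_cases h with ⟨k, hk, hy⟩ | ⟨k, hk, hy⟩
  · obtain rfl : k = j := Subtype.ext ((hp.index k v hy).symm.trans hv)
    exact ⟨hk.symm, hy⟩
  · have h1 : c (p j).1 = k := by rw [← hu, hp.index k u hy]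
    exact (hp.parent_asymm h1 (by rw [hk, hv])).elim

theorem reduced_adj_parent (hp : IsStarSystem c r p) (j : {j // j ≠ r}) :
    (reducedGraph c (starGraph p)).Adj j (c (p j).1) := by
  obtain ⟨y, hy⟩ := hp.nonempty j
  exact ⟨(hp.parent_ne j).symm, y, _, hp.index j y hy, rfl, (hp.adj_center hy).symm⟩

theorem reduced_adj_cases (hp : IsStarSystem c r p) {i k : ι}
    (h : (reducedGraph c (starGraph p)).Adj i k) :
    (∃ hi : i ≠ r, c (p ⟨i, hi⟩).1 = k) ∨ ∃ hk : k ≠ r, c (p ⟨k, hk⟩).1 = i := by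
  obtain ⟨_, x, y, rfl, rfl, hxy⟩ := h
  rcases adj_cases hxy with ⟨j, hj, hy⟩ | ⟨j, hj, hy⟩
  · right
    have := hp.index j y hy
    refine ⟨this ▸ j.2, ?_⟩
    rw [← hj]
    congr 3
    exact Subtype.ext this
  · left
    have := hp.index j x hy
    refine ⟨this ▸ j.2, ?_⟩
    rw [← hj]
    congr 3
    exact Subtype.ext this

/-- The chain of parents of `i` is a path to `r` in the reduced graph. -/
theorem exists_path (hp : IsStarSystem c r p) {d : ι → Ordinal}
    (hd : ∀ j : {j // j ≠ r}, d (c (p j).1) < d j) (i : ι) :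
    ∃ w : (reducedGraph c (starGraph p)).Walk i r, w.IsPath ∧ ∀ k ∈ w.support, d k ≤ d i := by
  induction i using hp.grounded.induction with
  | _ i ih =>
    by_cases hi : i = r
    · subst hi
      exact ⟨.nil, .nil, by simp⟩
    · obtain ⟨w, hw, hwd⟩ := ih _ ⟨hi, rfl⟩
      have hlt := hd ⟨i, hi⟩
      refine ⟨.cons (hp.reduced_adj_parent ⟨i, hi⟩) w, hw.cons fun h => ?_, ?_⟩
      · exact (hwd i h).not_gt hlt
      · intro k hk
        rw [SimpleGraph.Walk.support_cons, List.mem_cons] at hk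
        rcases hk with rfl | hk
        · exact le_rfl
        · exact (hwd k hk).trans hlt.le

theorem isAcyclic_starGraph (hp : IsStarSystem c r p) : (starGraph p).IsAcyclic := by
  obtain ⟨d, hd⟩ := hp.grounded.exists_rank
  have key : ∀ u v, (starGraph p).Adj u v → d (c v) ≤ d (c u) →
      ∃ h : c u ≠ r, v = (p ⟨c u, h⟩).1 := by
    intro u v huv hle
    rcases adj_cases huv with ⟨j, rfl, hy⟩ | ⟨j, rfl, hy⟩
    · rw [hp.index j v hy] at hle
      exact (hle.not_gt (hd j)).elim
    · have := hp.index j u hy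
      refine ⟨this ▸ j.2, ?_⟩
      congr 2
      exact Subtype.ext this.symm
  refine isAcyclic_of_rank (fun x => d (c x)) fun u v w hv hw hdv hdw => ?_
  obtain ⟨_, h1⟩ := key u v hv hdv
  obtain ⟨_, h2⟩ := key u w hw hdw
  rw [h1, h2]

theorem isTree_reducedGraph (hp : IsStarSystem c r p) :
    (reducedGraph c (starGraph p)).IsTree := by
  obtain ⟨d, hd⟩ := hp.grounded.exists_rank
  have key : ∀ i k, (reducedGraph c (starGraph p)).Adj i k → d k ≤ d i →
      ∃ h : i ≠ r, k = c (p ⟨i, h⟩).1 := by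
    intro i k hik hle
    rcases hp.reduced_adj_cases hik with ⟨hi, rfl⟩ | ⟨hk, rfl⟩
    · exact ⟨hi, rfl⟩
    · exact (hle.not_gt (hd ⟨k, hk⟩)).elim
  have hreach : ∀ i, (reducedGraph c (starGraph p)).Reachable i r := fun i =>
    (hp.exists_path hd i).choose.reachable
  refine ⟨(SimpleGraph.connected_iff _).2 ⟨fun i k => (hreach i).trans (hreach k).symm, ⟨r⟩⟩,
    isAcyclic_of_rank d fun i k k' hk hk' hdk hdk' => ?_⟩
  obtain ⟨_, h1⟩ := key i k hk hdk
  obtain ⟨_, h2⟩ := key i k' hk' hdk'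
  rw [h1, h2]

theorem isRootedForest (hp : IsStarSystem c r p) : IsRootedForest c r (starGraph p) where
  acyclic := hp.isAcyclic_starGraph
  no_inner_line x y h := by
    rcases adj_cases h with ⟨j, rfl, hy⟩ | ⟨j, rfl, hy⟩
    · rw [hp.index j y hy]
      exact hp.parent_ne j
    · rw [hp.index j x hy]
      exact (hp.parent_ne j).symm
  reduced_isTree := hp.isTree_reducedGraph
  single_root := by
    rintro i j hj hadj ⟨w, hw, hi⟩
    obtain ⟨d, hd⟩ := hp.grounded.exists_rank
    obtain ⟨w', hw', hwd⟩ := hp.exists_path hd (c (p ⟨j, hj⟩).1)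
    have hcons : (SimpleGraph.Walk.cons (hp.reduced_adj_parent ⟨j, hj⟩) w').IsPath :=
      hw'.cons fun h => (hwd j h).not_gt (hd ⟨j, hj⟩)
    have hac := hp.isTree_reducedGraph.2
    -- In the reduced tree the first step of the path from `j` to `r` goes to the parent of `j`.
    have h1 := hac.eq_snd_of_adj_start hw hadj hi
    have h2 := hac.eq_snd_of_adj_start hw (hp.reduced_adj_parent ⟨j, hj⟩) (by
      rw [(hp.isTree_reducedGraph.existsUnique_path j r).unique hw hcons]
      simp)
    have h3 : i = c (p ⟨j, hj⟩).1 := h1.trans h2.symm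
    exact ⟨_, h3.symm, fun u v hu hv huv => (hp.eq_center_of_adj huv hv (hu.trans h3)).1⟩

/-- The graph determines the parent map, by induction along the chain of parents: a neighbour of `i`
in the reduced graph is its parent or has `i` as its parent, and the second case is excluded for
`c (p i).1` by the induction hypothesis. -/
theorem parent_eq_of_starGraph_eq (hp : IsStarSystem c r p) (hq : IsStarSystem c r q)
    (h : starGraph p = starGraph q) (j : {j // j ≠ r}) : c (p j).1 = c (q j).1 := by
  have key : ∀ i (hi : i ≠ r), c (p ⟨i, hi⟩).1 = c (q ⟨i, hi⟩).1 := by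
    intro i
    induction i using hp.grounded.induction with
    | _ i ih =>
      intro hi
      have hadj := hp.reduced_adj_parent ⟨i, hi⟩
      rw [h] at hadj
      rcases hq.reduced_adj_cases hadj with ⟨_, h1⟩ | ⟨hk, h1⟩
      · exact h1.symm
      · have h2 := ih _ ⟨hi, rfl⟩ hk
        exact (hp.parent_asymm (j := ⟨i, hi⟩) (k := ⟨_, hk⟩) rfl (h2.trans h1)).elim
  exact key j.1 j.2

/-- Once the parent of `j` is known, the star of `j` consists of the lines between the two sets. -/
theorem starGraph_injective (hp : IsStarSystem c r p) (hq : IsStarSystem c r q)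
    (h : starGraph p = starGraph q) : p = q := by
  have hpar := hp.parent_eq_of_starGraph_eq hq h
  have hpq : ∀ j, ∀ y ∈ (p j).2, (p j).1 = (q j).1 ∧ y ∈ (q j).2 := fun j y hy =>
    hq.eq_center_of_adj (h ▸ hp.adj_center hy) (hp.index j y hy) (hpar j)
  have hqp : ∀ j, ∀ y ∈ (q j).2, (q j).1 = (p j).1 ∧ y ∈ (p j).2 := fun j y hy =>
    hp.eq_center_of_adj (h.symm ▸ hq.adj_center hy) (hq.index j y hy) (hpar j).symm
  funext j
  obtain ⟨y, hy⟩ := hp.nonempty j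
  exact Prod.ext (hpq j y hy).1
    (Finset.ext fun z => ⟨fun hz => (hpq j z hz).2, fun hz => (hqp j z hz).2⟩)

theorem prod_edgeFinset {R : Type*} [CommMonoid R] (hp : IsStarSystem c r p)
    [Fintype {j // j ≠ r}] [Fintype (starGraph p).edgeSet] (φ : Sym2 X → R) :
    ∏ e ∈ (starGraph p).edgeFinset, φ e = ∏ j, ∏ y ∈ (p j).2, φ s((p j).1, y) := by
  classical
  rw [Finset.prod_sigma']
  symm
  refine Finset.prod_bij (fun z _ => s((p z.1).1, z.2)) ?_ ?_ ?_ fun _ _ => rfl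
  · rintro ⟨j, y⟩ hz
    rw [SimpleGraph.mem_edgeFinset, SimpleGraph.mem_edgeSet]
    exact hp.adj_center (Finset.mem_sigma.1 hz).2
  · rintro ⟨j, y⟩ hz ⟨k, z⟩ hz' h
    have hy := hp.index j y (Finset.mem_sigma.1 hz).2
    have hy' := hp.index k z (Finset.mem_sigma.1 hz').2
    rcases Sym2.eq_iff.1 h with ⟨_, h2⟩ | ⟨h1, h2⟩
    · dsimp only at h2 hy hy'
      subst h2
      obtain rfl : j = k := Subtype.ext (hy.symm.trans hy')
      rfl
    · dsimp only at h1 h2 hy hy'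
      exact (hp.parent_asymm (j := j) (k := k) (by rw [h1, hy']) (by rw [← h2, hy])).elim
  · intro e
    induction e using Sym2.ind with
    | _ u v =>
      intro he
      rw [SimpleGraph.mem_edgeFinset, SimpleGraph.mem_edgeSet] at he
      rcases adj_cases he with ⟨j, rfl, hy⟩ | ⟨j, rfl, hy⟩
      · exact ⟨⟨j, v⟩, by simpa using hy, rfl⟩
      · exact ⟨⟨j, u⟩, by simpa using hy, Sym2.eq_swap⟩

end IsStarSystem

/-- Every rooted forest comes from a star system: the parent of `j` is the second point of the path
from `j` to `r` in the reduced tree. -/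
theorem IsRootedForest.exists_isStarSystem [Fintype X] {G : SimpleGraph X}
    (hG : IsRootedForest c r G) : ∃ p, IsStarSystem c r p ∧ starGraph p = G := by
  classical
  have hT := hG.reduced_isTree
  choose w hw huniq using fun i => hT.existsUnique_path i r
  have hnil : ∀ j : {j // j ≠ r}, ¬ (w j).Nil := fun j h => j.2 h.eq
  have hadj : ∀ j : {j // j ≠ r}, (reducedGraph c G).Adj j (w j).snd :=
    fun j => (w j).adj_snd (hnil j)
  choose x hx hroot using fun j : {j // j ≠ r} =>
    hG.single_root (w j).snd j j.2 (hadj j) ⟨w j, hw j, (w j).getVert_mem_support _⟩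
  have hp : IsStarSystem c r fun j => (x j, Finset.univ.filter fun y => c y = j ∧ G.Adj (x j) y) := by
    refine ⟨fun j => ?_, fun j y hy => ?_, ?_⟩
    · obtain ⟨_, y, u, hy, hu, h⟩ := hadj j
      obtain rfl := hroot j u y hu hy h.symm
      exact ⟨y, by simpa using ⟨hy, h.symm⟩⟩
    · simp only [Finset.mem_filter] at hy
      exact hy.2.1
    · refine isGrounded_of_rank (fun i => (w i).length) fun j => ?_
      have h1 : w (w j).snd = (w j).tail := (huniq _ _ (hw j).tail).symm
      have h2 := SimpleGraph.Walk.length_tail_add_one (hnil j)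
      change (w (c (x j))).length < (w j).length
      rw [hx, h1]
      omega
  refine ⟨_, hp, ?_⟩
  -- If the path from `c v` to `r` passes through `c u`, the line belongs to the star of `c v`.
  have key : ∀ u v, G.Adj u v → c u ∈ (w (c v)).support →
      ∃ j : {j // j ≠ r}, x j = u ∧ c v = j ∧ G.Adj (x j) v := by
    intro u v huv hmem
    have hne := hG.no_inner_line u v huv
    have hred : (reducedGraph c G).Adj (c v) (c u) := ⟨hne.symm, v, u, rfl, rfl, huv.symm⟩
    have hvr : c v ≠ r := by
      intro h
      have h2 : ∀ i, i = r → (w i).support = [r] := by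
        rintro _ rfl
        rw [← huniq _ .nil .nil, SimpleGraph.Walk.support_nil]
      rw [h2 _ h, List.mem_singleton] at hmem
      exact hne (hmem.trans h.symm)
    have hsnd := hT.2.eq_snd_of_adj_start (hw (c v)) hred hmem
    have := hroot ⟨c v, hvr⟩ u v hsnd rfl huv
    exact ⟨⟨c v, hvr⟩, this.symm, rfl, this ▸ huv⟩
  ext u v
  constructor
  · intro h
    rcases IsStarSystem.adj_cases h with ⟨j, rfl, hy⟩ | ⟨j, rfl, hy⟩
    · simp only [Finset.mem_filter] at hy
      exact hy.2.2
    · simp only [Finset.mem_filter] at hy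
      exact hy.2.2.symm
  · intro h
    have hne := hG.no_inner_line u v h
    have hred : (reducedGraph c G).Adj (c u) (c v) := ⟨hne, u, v, rfl, rfl, h⟩
    refine (SimpleGraph.fromRel_adj _ _ _).2 ⟨h.ne, ?_⟩
    by_cases hmem : c u ∈ (w (c v)).support
    · obtain ⟨j, hj⟩ := key u v h hmem
      exact Or.inl ⟨j, hj.1, by simpa using hj.2⟩
    · have hmem' : c v ∈ (w (c u)).support := by
        rw [← huniq _ _ ((hw (c v)).cons (h := hred) hmem)]
        simp
      obtain ⟨j, hj⟩ := key v u h.symm hmem'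
      exact Or.inr ⟨j, hj.1, by simpa using hj.2⟩

end Stars

/-! ### The sum over rooted forests as a determinant -/

open Classical in
/-- The sum over star systems is evaluated by the matrix-tree theorem. For a fixed centre `x`, the
sum over the nonempty sets of leaves in the set `j` is `∏ y, (1 + φ s(x, y)) - 1`. -/
theorem sum_isRootedForest_eq_det {X ι R : Type*} [Fintype X] [Fintype ι]
    [DecidableEq ι] [CommRing R] [IsDomain R]
    (c : X → ι) (r : ι) (φ : Sym2 X → R) :
    ∑ G : SimpleGraph X with IsRootedForest c r G, ∏ e ∈ G.edgeFinset, φ e =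
      (Matrix.of fun j k : {j // j ≠ r} =>
        ∑ x, (∏ y with c y = j, (1 + φ s(x, y)) - 1) *
          ((if j = k then 1 else 0) - if c x = k then 1 else 0)).det := by
  set A : {j // j ≠ r} → Finset (X × Finset X) := fun j =>
    Finset.univ ×ˢ (Finset.univ.filter fun y => c y = j).powerset.erase ∅ with hA
  have hentry : (Matrix.of fun j k : {j // j ≠ r} =>
        ∑ x, (∏ y with c y = j, (1 + φ s(x, y)) - 1) *
          ((if j = k then 1 else 0) - if c x = k then 1 else 0)) =
      Matrix.of fun j k : {j // j ≠ r} => ∑ y ∈ A j, (∏ z ∈ y.2, φ s(y.1, z)) *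
        ((if j = k then 1 else 0) - if c y.1 = k then 1 else 0) := by
    ext j k
    simp only [Matrix.of_apply, hA, Finset.sum_product]
    refine Finset.sum_congr rfl fun x _ => ?_
    have hx : ∏ y with c y = j, (1 + φ s(x, y)) - 1 =
        ∑ S ∈ (Finset.univ.filter fun y => c y = j).powerset.erase ∅, ∏ z ∈ S, φ s(x, z) := by
      rw [Finset.sum_erase_eq_sub (Finset.empty_mem_powerset _), Finset.prod_one_add,
        Finset.prod_empty]
    rw [hx, Finset.sum_mul]
  rw [hentry, ← sum_isGrounded_eq_det r A (fun _ y => ∏ z ∈ y.2, φ s(y.1, z)) fun y => c y.1]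
  have hstar : ∀ p : {j // j ≠ r} → X × Finset X,
      p ∈ (Fintype.piFinset A).filter (fun p => IsGrounded r fun j => c (p j).1) ↔
        IsStarSystem c r p := by
    intro p
    simp only [Finset.mem_filter, Fintype.mem_piFinset, hA, Finset.mem_product, Finset.mem_univ,
      true_and, Finset.mem_erase, Finset.mem_powerset, ← Finset.nonempty_iff_ne_empty]
    refine ⟨fun h => ⟨fun j => (h.1 j).1, fun j y hy => ?_, h.2⟩,
      fun h => ⟨fun j => ⟨h.nonempty j, fun y hy => ?_⟩, h.grounded⟩⟩
    · exact (Finset.mem_filter.1 ((h.1 j).2 hy)).2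
    · exact Finset.mem_filter.2 ⟨Finset.mem_univ _, h.index j y hy⟩
  symm
  refine Finset.sum_bij (fun p _ => starGraph p) ?_ ?_ ?_ ?_
  · intro p hp
    exact Finset.mem_filter.2 ⟨Finset.mem_univ _, ((hstar p).1 hp).isRootedForest⟩
  · intro p hp q hq h
    exact ((hstar p).1 hp).starGraph_injective ((hstar q).1 hq) h
  · intro G hG
    obtain ⟨p, hp, h⟩ := (Finset.mem_filter.1 hG).2.exists_isStarSystem
    exact ⟨p, (hstar p).2 hp, h⟩
  · intro p hp
    exact (((hstar p).1 hp).prod_edgeFinset φ).symm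

/-! ### Evaluation of the determinant -/

/-- The matrix is a diagonal matrix times a perturbation of the identity of rank at most two, so
that its determinant reduces to one of size two. -/
theorem det_two_row_types {α β K : Type*} [Fintype α] [Fintype β] [DecidableEq α] [DecidableEq β]
    [Field K] (B ν : α → K) (l a N Y : K) (hN : N ≠ 0) (hY : Y ≠ 0) :
    (Matrix.of fun j k : α ⊕ β => Sum.elim
      (fun i => B i * ((if Sum.inl i = k then N else 0) - Sum.elim ν (fun _ => 1) k))
      (fun b => (if Sum.inr b = k then Y else 0) - Sum.elim (fun i => l * ν i) (fun _ => a) k)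
      j).det =
    (∏ i, B i) * N ^ Fintype.card α * Y ^ Fintype.card β *
      ((1 - (∑ i, ν i) / N) * (1 - Fintype.card β * a / Y) -
        Fintype.card β / Y * (l * (∑ i, ν i) / N)) := by
  set U : Matrix (α ⊕ β) (Fin 2) K := Matrix.of fun j =>
    Sum.elim (fun _ => ![N⁻¹, 0]) (fun _ => ![0, Y⁻¹]) j with hU
  set W : Matrix (Fin 2) (α ⊕ β) K := Matrix.of
    ![Sum.elim ν (fun _ => 1), Sum.elim (fun i => l * ν i) (fun _ => a)] with hW
  have hfactor : (Matrix.of fun j k : α ⊕ β => Sum.elim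
      (fun i => B i * ((if Sum.inl i = k then N else 0) - Sum.elim ν (fun _ => 1) k))
      (fun b => (if Sum.inr b = k then Y else 0) - Sum.elim (fun i => l * ν i) (fun _ => a) k)
      j) = Matrix.diagonal (Sum.elim (fun i => B i * N) fun _ => Y) * (1 - U * W) := by
    ext j k
    rw [Matrix.diagonal_mul, Matrix.sub_apply, Matrix.mul_apply, Fin.sum_univ_two,
      Matrix.one_apply, Matrix.of_apply]
    rcases j with i | b
    · have : N * (N⁻¹ * Sum.elim ν (fun _ => 1) k) = Sum.elim ν (fun _ => (1 : K)) k :=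
        mul_inv_cancel_left₀ hN _
      simp only [Sum.elim_inl, hU, hW, Matrix.of_apply, Matrix.cons_val_zero, Matrix.cons_val_one,
        zero_mul, add_zero]
      split_ifs <;> linear_combination (B i) * this
    · have : Y * (Y⁻¹ * Sum.elim (fun i => l * ν i) (fun _ => a) k) =
          Sum.elim (fun i => l * ν i) (fun _ => a) k := mul_inv_cancel_left₀ hY _
      simp only [Sum.elim_inr, hU, hW, Matrix.of_apply, Matrix.cons_val_zero, Matrix.cons_val_one,
        zero_mul, zero_add]
      split_ifs <;> linear_combination this
  rw [hfactor, Matrix.det_mul, Matrix.det_diagonal, Matrix.det_one_sub_mul_comm,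
    Matrix.det_fin_two, Fintype.prod_sum_type]
  simp only [Sum.elim_inl, Sum.elim_inr, Finset.prod_mul_distrib, Finset.prod_const,
    Finset.card_univ, Matrix.sub_apply, Matrix.mul_apply, Fintype.sum_sum_type, hU, hW,
    Matrix.of_apply, Matrix.cons_val_zero, Matrix.cons_val_one, mul_zero, Finset.sum_const_zero,
    add_zero, zero_add, ← Finset.sum_mul, ← Finset.mul_sum, Finset.sum_const, nsmul_eq_mul,
    Matrix.one_apply_eq, Matrix.one_apply_ne zero_ne_one, Matrix.one_apply_ne one_ne_zero]
  ring

/-- Removing the point `inl r` from a sum type. -/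
def sumNeEquiv {A B : Type*} (r : A) :
    {i : A // i ≠ r} ⊕ B ≃ {j : A ⊕ B // j ≠ Sum.inl r} where
  toFun := Sum.elim (fun i => ⟨Sum.inl i.1, fun h => i.2 (Sum.inl_injective h)⟩)
    fun b => ⟨Sum.inr b, Sum.inr_ne_inl⟩
  invFun
    | ⟨Sum.inl i, h⟩ => Sum.inl ⟨i, fun h' => h (congrArg _ h')⟩
    | ⟨Sum.inr b, _⟩ => Sum.inr b
  left_inv := by rintro (i | b) <;> rfl
  right_inv := by rintro ⟨i | b, h⟩ <;> rfl

section Factors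

variable {A B : Type*} (a l : ℝ)

theorem lineFactor_inl_right (x : A ⊕ B) (v : A) : lineFactor a l s(x, Sum.inl v) = l := by
  simp [lineFactor]

theorem lineFactor_inl_left (v : A) (x : A ⊕ B) : lineFactor a l s(Sum.inl v, x) = l := by
  simp [lineFactor]

theorem lineFactor_inr_inr (b b' : B) :
    lineFactor a l s((Sum.inr b : A ⊕ B), Sum.inr b') = a := by
  simp [lineFactor]

variable {m : ℕ} (V : Fin m → Type*) [∀ i, Fintype (V i)] (n : ℕ)

open Classical in
theorem sum_setIndex_eq_inl (i : Fin m) (g : (Σ i, V i) ⊕ Fin n → ℝ) :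
    ∑ x with setIndex V n x = Sum.inl i, g x = ∑ v : V i, g (Sum.inl ⟨i, v⟩) := by
  rw [Finset.sum_filter, Fintype.sum_sum_type, Fintype.sum_sigma]
  simp only [setIndex, Sum.map_inl, Sum.map_inr, Sum.inl.injEq, reduceCtorEq, if_false,
    Finset.sum_const_zero, add_zero]
  rw [Finset.sum_eq_single i]
  · simp
  · intro k _ hk
    simp [hk]
  · simp

open Classical in
theorem filter_setIndex_eq_inr (b : Fin n) :
    (Finset.univ.filter fun x => setIndex V n x = Sum.inr b) = {Sum.inr b} := by
  ext x
  rw [Finset.mem_filter, Finset.mem_singleton]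
  rcases x with x | x <;> simp [setIndex]

open Classical in
theorem prod_setIndex_eq_inl (i : Fin m) (x : (Σ i, V i) ⊕ Fin n) :
    ∏ y with setIndex V n y = Sum.inl i, (1 + lineFactor a l s(x, y)) =
      (1 + l) ^ Fintype.card (V i) := by
  have hcard : (Finset.univ.filter fun y => setIndex V n y = Sum.inl i).card =
      Fintype.card (V i) := by
    have := sum_setIndex_eq_inl V n i fun _ => 1
    simp only [Finset.sum_const, nsmul_eq_mul, mul_one, Finset.card_univ] at this
    exact_mod_cast this
  rw [← hcard]
  refine Finset.prod_eq_pow_card fun y hy => ?_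
  have hy := (Finset.mem_filter.1 hy).2
  rcases y with y | y
  · rw [lineFactor_inl_right]
  · simp [setIndex] at hy

open Classical in
/-- The matrix of the directed matrix-tree theorem for the collection of the sets `V i` and the
additional vertices has two types of rows. -/
theorem forestMatrix_submatrix (r : Fin m) :
    (Matrix.of fun j k : {j : Fin m ⊕ Fin n // j ≠ Sum.inl r} =>
        ∑ x, (∏ y with setIndex V n y = j, (1 + lineFactor a l s(x, y)) - 1) *
          ((if j = k then (1 : ℝ) else 0) - if setIndex V n x = k then 1 else 0)).submatrix
      (sumNeEquiv r) (sumNeEquiv r) =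
    Matrix.of fun j k : {i : Fin m // i ≠ r} ⊕ Fin n => Sum.elim
      (fun i : {i : Fin m // i ≠ r} => ((1 + l) ^ Fintype.card (V i) - 1) *
        ((if Sum.inl i = k then (Fintype.card (Σ i, V i) : ℝ) + n else 0) -
          Sum.elim (fun i : {i : Fin m // i ≠ r} => (Fintype.card (V i) : ℝ)) (fun _ => 1) k))
      (fun b => (if Sum.inr b = k then l * (Fintype.card (Σ i, V i) : ℝ) + n * a else 0) -
        Sum.elim (fun i : {i : Fin m // i ≠ r} => l * (Fintype.card (V i) : ℝ)) (fun _ => a) k) j := by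
  have hsum : ∀ (g : (Σ i, V i) ⊕ Fin n → ℝ) (j k : {i : Fin m // i ≠ r} ⊕ Fin n),
      ∑ x, g x * ((if sumNeEquiv r j = sumNeEquiv r k then (1 : ℝ) else 0) -
        if setIndex V n x = (sumNeEquiv r k).1 then 1 else 0) =
      (if j = k then ∑ x, g x else 0) - ∑ x with setIndex V n x = (sumNeEquiv r k).1, g x := by
    intro g j k
    simp only [mul_sub, Finset.sum_sub_distrib, mul_ite, mul_one, mul_zero,
      (sumNeEquiv r).injective.eq_iff, Finset.sum_filter]
    split_ifs <;> simp
  ext j k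
  rw [Matrix.submatrix_apply, Matrix.of_apply, Matrix.of_apply, hsum]
  rcases j with i | b
  · have hj : ((sumNeEquiv r (Sum.inl i) : {j : Fin m ⊕ Fin n // j ≠ Sum.inl r}) : Fin m ⊕ Fin n) =
      Sum.inl i.1 := rfl
    simp only [hj, prod_setIndex_eq_inl, Sum.elim_inl]
    rcases k with k | k
    · have hk : ((sumNeEquiv r (Sum.inl k) : {j : Fin m ⊕ Fin n // j ≠ Sum.inl r}) :
        Fin m ⊕ Fin n) = Sum.inl k.1 := rfl
      rw [hk, sum_setIndex_eq_inl]
      simp only [Finset.sum_const, Finset.card_univ, Fintype.card_sum, Fintype.card_fin,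
        nsmul_eq_mul, Nat.cast_add, Sum.elim_inl]
      split_ifs <;> ring
    · have hk : ((sumNeEquiv r (Sum.inr k) : {j : Fin m ⊕ Fin n // j ≠ Sum.inl r}) :
        Fin m ⊕ Fin n) = Sum.inr k := rfl
      rw [hk, filter_setIndex_eq_inr]
      simp
  · have hj : ((sumNeEquiv r (Sum.inr b) : {j : Fin m ⊕ Fin n // j ≠ Sum.inl r}) : Fin m ⊕ Fin n) =
      Sum.inr b := rfl
    have htotal : ∑ x : (Σ i, V i) ⊕ Fin n, lineFactor a l s(x, Sum.inr b) =
        l * (Fintype.card (Σ i, V i) : ℝ) + n * a := by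
      simp only [Fintype.sum_sum_type, lineFactor_inl_left, lineFactor_inr_inr, Finset.sum_const,
        Finset.card_univ, Fintype.card_fin, nsmul_eq_mul]
      ring
    simp only [hj, filter_setIndex_eq_inr, Finset.prod_singleton, add_sub_cancel_left, htotal,
      Sum.elim_inr]
    rcases k with k | k
    · have hk : ((sumNeEquiv r (Sum.inl k) : {j : Fin m ⊕ Fin n // j ≠ Sum.inl r}) :
        Fin m ⊕ Fin n) = Sum.inl k.1 := rfl
      rw [hk, sum_setIndex_eq_inl]
      simp only [lineFactor_inl_left, Finset.sum_const, Finset.card_univ, nsmul_eq_mul,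
        Sum.elim_inl]
      ring
    · have hk : ((sumNeEquiv r (Sum.inr k) : {j : Fin m ⊕ Fin n // j ≠ Sum.inl r}) :
        Fin m ⊕ Fin n) = Sum.inr k := rfl
      rw [hk, filter_setIndex_eq_inr]
      simp [lineFactor_inr_inr]

end Factors

theorem theorem3 {m n : ℕ} (hm : 1 ≤ m) (hn : 1 ≤ n) (V : Fin m → Type*) [∀ i, Fintype (V i)]
    (a l : ℝ) (ha : 0 < a) (hl : 0 < l) :
    forestWeight V ⟨0, hm⟩ n a l =
      (Fintype.card (V ⟨0, hm⟩) : ℝ) * l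
        * (∏ i ∈ Finset.univ.erase (⟨0, hm⟩ : Fin m), ((1 + l) ^ Fintype.card (V i) - 1))
        * ((Fintype.card (Σ i, V i) : ℝ) + n) ^ (m - 1)
        * (l * (Fintype.card (Σ i, V i) : ℝ) + n * a) ^ (n - 1) := by
  classical
  have hforest := sum_isRootedForest_eq_det (setIndex V n) (Sum.inl ⟨0, hm⟩) (lineFactor a l)
  set r : Fin m := ⟨0, hm⟩
  set v : ℝ := (Fintype.card (Σ i, V i) : ℝ) with hv
  have hn' : (0 : ℝ) < n := by exact_mod_cast hn
  have hv0 : 0 ≤ v := Nat.cast_nonneg _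
  have hN : v + n ≠ 0 := by positivity
  have hY : l * v + n * a ≠ 0 := by positivity
  have hcard : Fintype.card {i : Fin m // i ≠ r} = m - 1 := by simp
  have hprod : ∏ i : {i : Fin m // i ≠ r}, ((1 + l) ^ Fintype.card (V i) - 1) =
      ∏ i ∈ Finset.univ.erase r, ((1 + l) ^ Fintype.card (V i) - 1) :=
    (Finset.prod_subtype _ (by simp) fun i => (1 + l) ^ Fintype.card (V i) - 1).symm
  have hsum : ∑ i : {i : Fin m // i ≠ r}, (Fintype.card (V i) : ℝ) =
      v - Fintype.card (V r) := by
    rw [← Finset.sum_subtype (Finset.univ.erase r) (by simp) fun i => (Fintype.card (V i) : ℝ),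
      Finset.sum_erase_eq_sub (Finset.mem_univ r), hv, Fintype.card_sigma, Nat.cast_sum]
  have hweight : forestWeight V r n a l =
      ∑ G : SimpleGraph ((Σ i, V i) ⊕ Fin n) with IsRootedForest (setIndex V n) (Sum.inl r) G,
        ∏ e ∈ G.edgeFinset, lineFactor a l e := by
    unfold forestWeight
    convert rfl
  -- One of the `n` factors `l * v + n * a` cancels against the denominator of the determinant of
  -- size two.
  have hpow : (l * v + n * a) ^ n = (l * v + n * a) ^ (n - 1) * (l * v + n * a) :=
    (pow_sub_one_mul (by omega) _).symm
  rw [hweight]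
  calc _ = _ := by convert hforest
    _ = _ := (Matrix.det_submatrix_equiv_self (sumNeEquiv r) _).symm
    _ = _ := congrArg Matrix.det (by convert forestMatrix_submatrix a l V n r)
    _ = _ := det_two_row_types (fun i : {i : Fin m // i ≠ r} => (1 + l) ^ Fintype.card (V i) - 1)
      (fun i => (Fintype.card (V i) : ℝ)) l a (v + n) (l * v + n * a) hN hY
    _ = _ := by
      rw [hprod, hsum, hcard, Fintype.card_fin, hpow]
      field_simp
      ring
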